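/- A *spherical tangle diagram* is a planar diagram of a 1-punctured ball tangle: finitely many arcs and circles drawn in a disc from which the interior of a smaller disc (the hole) is removed, with finitely many over/under crossings, whose endpoints are four fixed points (NW, SW, SE, NE) on the outer boundary and four fixed points (NW, SW, SE, NE) on the boundary of the hole. For spherical tangle diagrams $S^{(1)},S^{(2)}$, the composite $S^{(2)}(S^{(1)})$ is the spherical tangle diagram obtained by filling the hole of $S^{(2)}$ with $S^{(1)}$, matching endpoints of the same name. For a spherical tangle diagram $S$ and $k,j\in\{1,2\}$ let $S_{k(j)}$ be the link diagram obtained by filling the hole with the fundamental tangle $j$ (two vertical arcs for $j=1$, two horizontal arcs for $j=2$) and taking the numerator closure for $k=1$ (joining NW to NE and SW to SE outside the disc) or the denominator closure for $k=2$ (joining NW to SW and NE to SE). Let $\langle L\rangle=\sum_{\sigma}A^{\alpha(\sigma)-\beta(\sigma)}(-A^2-A^{-2})^{d(\sigma)-1}$ be the Kauffman bracket of a link diagram $L$ at $A=e^{i\pi/4}$, where $\sigma$ runs over all states of $L$ (choices of an $A$- or $B$-type splitting at each crossing), $\alpha(\sigma)$ and $\beta(\sigma)$ are the numbers of $A$-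 and $B$-type splittings, and $d(\sigma)$ is the number of circles of the resulting diagram. Put $$F(S)=\left\{\begin{pmatrix} z\langle S_{1(1)}\rangle & -iz\langle S_{1(2)}\rangle\\ iz\langle S_{2(1)}\rangle & z\langle S_{2(2)}\rangle\end{pmatrix}\;\middle|\; z\in\mathbb C,\ z^8=1\right\}\cap M_{2\times2}(\mathbb Z).$$ Let $PM_{2\times 2}(\mathbb Z)$ be the quotient of $M_{2\times2}(\mathbb Z)$ by multiplication by $\pm1$, whose elements are the classes $[M]=\{M,-M\}$, with the product $[M][N]=[MN]$. **Corollary 3.6.** For all spherical tangle diagrams $S^{(1)},S^{(2)}$, the sets $F(S^{(1)})$, $F(S^{(2)})$ and $F(S^{(2)}(S^{(1)}))$ are elements of $PM_{2\times2}(\mathbb Z)$, and $$F(S^{(2)}(S^{(1)}))=F(S^{(2)})\,F(S^{(1)}).$$ -/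

import Mathlib

noncomputable section

/-! ### Combinatorial maps -/

/-- The number of orbits on `D` of the group generated by a set `S` of permutations. -/
def numOrbits {D : Type} (S : Set (Equiv.Perm D)) : ℕ :=
  Nat.card (MulAction.orbitRel.Quotient (Subgroup.closure S) D)

/-- A graph drawn on a closed oriented surface, as a combinatorial map: `D` is the set of darts
(half-edges), `σ` sends a dart to the next dart counterclockwise around its vertex and `e` exchanges
the two halves of every edge. Vertices, edges, faces and connected components are the orbits of `σ`,
of `e`, of `σ⁻¹ e` (walk along a dart, then turn so as to keep the same face on the left) and of the
group generated by `σ` and `e`. The map is planar when each component lies on a sphere, that is, by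
Euler's formula, when `V - E + F = 2 c`. -/
def IsPlanarMap {D : Type} (σ e : Equiv.Perm D) : Prop :=
  numOrbits {σ} + numOrbits {σ⁻¹ * e} = numOrbits {e} + 2 * numOrbits {σ, e}

/-! ### Diagrams of spherical tangles -/

/-- The darts of a spherical tangle diagram with set of crossings `X` and set of beads `P`.
A bead is a marked point of the diagram that is not a crossing, that is, a vertex of degree two;
beads allow for closed components without crossings, and for gluing. The region outside of the
outer ball and the region inside the hole are regarded as two further vertices, of degree four.

The darts at a crossing are numbered counterclockwise so that the over-strand consists of the darts
`0` and `2`. The four endpoints on the outer ball, and those on the hole, are numbered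
counterclockwise in the plane: `0` north-west, `1` south-west, `2` south-east, `3` north-east. -/
inductive Dart (X P : Type) : Type
  | crossing (x : X) (j : ZMod 4)
  | bead (p : P) (b : Bool)
  | outer (j : ZMod 4)
  | hole (j : ZMod 4)

namespace Dart

variable {X P : Type}

/-- The next dart counterclockwise around the same vertex. Seen from the outer region (a vertex at
infinity of the plane) the order of the four outer endpoints is reversed. -/
def rot (X P : Type) : Equiv.Perm (Dart X P) where
  toFun
    | crossing x j => crossing x (j + 1)
    | bead p b => bead p (!b)
    | outer j => outer (j - 1)
    | hole j => hole (j + 1)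
  invFun
    | crossing x j => crossing x (j - 1)
    | bead p b => bead p (!b)
    | outer j => outer (j + 1)
    | hole j => hole (j - 1)
  left_inv d := by cases d <;> simp
  right_inv d := by cases d <;> simp

/-- Darts as a disjoint union. -/
def equivSum (X P : Type) :
    Dart X P ≃ ((X × ZMod 4) ⊕ (P × Bool)) ⊕ (ZMod 4 ⊕ ZMod 4) where
  toFun
    | crossing x j => .inl (.inl (x, j))
    | bead p b => .inl (.inr (p, b))
    | outer j => .inr (.inl j)
    | hole j => .inr (.inr j)
  invFun
    | .inl (.inl (x, j)) => crossing x j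
    | .inl (.inr (p, b)) => bead p b
    | .inr (.inl j) => outer j
    | .inr (.inr j) => hole j
  left_inv d := by cases d <;> rfl
  right_inv d := by rcases d with ((_ | _) | (_ | _)) <;> rfl

instance [Finite X] [Finite P] : Finite (Dart X P) := Finite.of_equiv _ (equivSum X P).symm

/-- Gluing the outer endpoints of one diagram to the hole endpoints of a second diagram. The two
darts that meet at each of the four glued points become the two darts of a new bead. -/
def glue (X₁ P₁ X₂ P₂ : Type) :
    Dart X₁ P₁ ⊕ Dart X₂ P₂ ≃ Dart (X₁ ⊕ X₂) ((P₁ ⊕ P₂) ⊕ ZMod 4) where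
  toFun
    | .inl (crossing x j) => crossing (.inl x) j
    | .inl (bead p b) => bead (.inl (.inl p)) b
    | .inl (outer j) => bead (.inr j) false
    | .inl (hole j) => hole j
    | .inr (crossing x j) => crossing (.inr x) j
    | .inr (bead p b) => bead (.inl (.inr p)) b
    | .inr (outer j) => outer j
    | .inr (hole j) => bead (.inr j) true
  invFun
    | crossing (.inl x) j => .inl (crossing x j)
    | crossing (.inr x) j => .inr (crossing x j)
    | bead (.inl (.inl p)) b => .inl (bead p b)
    | bead (.inl (.inr p)) b => .inr (bead p b)
    | bead (.inr j) false => .inl (outer j)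
    | bead (.inr j) true => .inr (hole j)
    | outer j => .inr (outer j)
    | hole j => .inl (hole j)
  left_inv d := by rcases d with ((_ | _ | _ | _) | (_ | _ | _ | _)) <;> rfl
  right_inv
    | crossing (.inl _) _ => rfl
    | crossing (.inr _) _ => rfl
    | bead (.inl (.inl _)) _ => rfl
    | bead (.inl (.inr _)) _ => rfl
    | bead (.inr _) false => rfl
    | bead (.inr _) true => rfl
    | outer _ => rfl
    | hole _ => rfl

end Dart

/-- A diagram of a spherical tangle (a 1-punctured ball tangle): finitely many crossings and beads,
and arcs without further crossings that join their darts, the four outer endpoints and the four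
endpoints on the hole in pairs, such that the whole is drawn without genus. -/
structure SphericalTangle where
  X : Type
  P : Type
  [fintypeX : Fintype X]
  [decEqX : DecidableEq X]
  [finiteP : Finite P]
  edge : Equiv.Perm (Dart X P)
  edge_edge : ∀ d, edge (edge d) = d
  edge_ne : ∀ d, edge d ≠ d
  planar : IsPlanarMap (Dart.rot X P) edge

attribute [instance] SphericalTangle.fintypeX SphericalTangle.decEqX SphericalTangle.finiteP

/-! ### Planarity is preserved under gluing

Over the field with two elements, a map is planar if and only if each cycle of edges is the
boundary of a set of faces. -/

section Planarity

/-- Functions on `D` that are invariant under all permutations in `S`. -/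
def invariantFun {D : Type} (S : Set (Equiv.Perm D)) : Submodule (ZMod 2) (D → ZMod 2) where
  carrier := {f | ∀ s ∈ S, ∀ d, f (s d) = f d}
  add_mem' hf hg s hs d := by simp [hf s hs d, hg s hs d]
  zero_mem' _ _ _ := rfl
  smul_mem' c f hf s hs d := by simp [hf s hs d]

theorem finrank_invariantFun {D : Type} [Finite D] (S : Set (Equiv.Perm D)) :
    Module.finrank (ZMod 2) (invariantFun S) = numOrbits S := by
  classical
  let Q := MulAction.orbitRel.Quotient (Subgroup.closure S) D
  have key : ∀ f ∈ invariantFun S, ∀ a b : D,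
      (MulAction.orbitRel (Subgroup.closure S) D) a b → f a = f b := by
    intro f hf a b hab
    rw [MulAction.orbitRel_apply] at hab
    obtain ⟨⟨s, hs⟩, rfl⟩ := hab
    change f (s b) = f b
    induction hs using Subgroup.closure_induction generalizing b with
    | mem s h => exact hf s h b
    | one => rfl
    | mul x y _ _ hx hy => rw [Equiv.Perm.mul_apply, hx, hy]
    | inv x _ hx => simpa using (hx (x⁻¹ b)).symm
  let E : invariantFun S ≃ₗ[ZMod 2] (Q → ZMod 2) :=
    { toFun := fun f q => Quotient.lift f.1 (key f.1 f.2) q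
      invFun := fun g => ⟨fun d => g (Quotient.mk _ d), fun s hs d =>
        congrArg g (Quotient.sound (show MulAction.orbitRel (Subgroup.closure S) D (s d) d from
          (MulAction.orbitRel_apply).2 ⟨⟨s, Subgroup.subset_closure hs⟩, rfl⟩))⟩
      left_inv := fun f => rfl
      right_inv := fun g => by
        funext q
        induction q using Quotient.inductionOn with
        | h d => rfl
      map_add' := fun f g => by
        funext q
        induction q using Quotient.inductionOn with
        | h d => rfl
      map_smul' := fun c g => by
        funext q
        induction q using Quotient.inductionOn with
        | h d => rfl }
  have : Fintype Q := Fintype.ofFinite Q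
  rw [E.finrank_eq, Module.finrank_fintype_fun_eq_card, numOrbits, Nat.card_eq_fintype_card]

variable {D : Type} [Fintype D] (σ e : Equiv.Perm D)

/-- The pairing of functions on edges with functions on vertices. -/
def pairing : invariantFun {e} →ₗ[ZMod 2] invariantFun {σ} →ₗ[ZMod 2] ZMod 2 :=
  LinearMap.mk₂ (ZMod 2) (fun f p => ∑ d, f.1 d * p.1 d)
    (fun f g p => by simp [add_mul, Finset.sum_add_distrib])
    (fun c f p => by simp [mul_assoc, Finset.mul_sum])
    (fun f g p => by simp [mul_add, Finset.sum_add_distrib])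
    (fun c f p => by simp [mul_left_comm, Finset.mul_sum])

/-- A map is planar if and only if each cycle is the boundary of a set of faces. -/
theorem isPlanarMap_iff (he : ∀ d, e (e d) = d) (hne : ∀ d, e d ≠ d) :
    IsPlanarMap σ e ↔
      ∀ f : D → ZMod 2, (∀ d, f (e d) = f d) →
        (∀ p : D → ZMod 2, (∀ d, p (σ d) = p d) → ∑ d, f d * p d = 0) →
        ∃ g : D → ZMod 2, (∀ d, g (σ⁻¹ d) = g (e d)) ∧ ∀ d, f d = g d + g (e d) := by
  classical
  have two : ∀ a : ZMod 2, a + a = 0 := by decide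
  have eq_of : ∀ a b : ZMod 2, a + b = 0 → b = a := by decide
  -- the boundary map from faces to edges
  let δ : invariantFun {σ⁻¹ * e} →ₗ[ZMod 2] invariantFun {e} :=
    { toFun := fun g => ⟨fun d => g.1 d + g.1 (e d), by
        rintro s rfl d
        simp [he, add_comm]⟩
      map_add' := fun g h => by ext d; simp; ring
      map_smul' := fun c g => by ext d; simp; ring }
  have inv_face : ∀ g : D → ZMod 2,
      g ∈ invariantFun {σ⁻¹ * e} ↔ ∀ d, g (σ⁻¹ d) = g (e d) := by
    intro g
    constructor
    · intro hg d
      have := hg _ rfl (e d)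
      simpa [he] using this
    · rintro hg s rfl d
      simpa [he] using hg (e d)
  have inv_one : ∀ (τ : Equiv.Perm D) (g : D → ZMod 2),
      g ∈ invariantFun {τ} ↔ ∀ d, g (τ d) = g d := by
    intro τ g
    exact ⟨fun h => h τ rfl, by rintro h s rfl; exact h⟩
  have inv_two : ∀ g : D → ZMod 2,
      g ∈ invariantFun {σ, e} ↔ (∀ d, g (σ d) = g d) ∧ ∀ d, g (e d) = g d := by
    intro g
    refine ⟨fun h => ⟨h σ (by simp), h e (by simp)⟩, ?_⟩
    rintro ⟨h1, h2⟩ s (rfl | rfl)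
    exacts [h1, h2]
  have hkerδ : Module.finrank (ZMod 2) (LinearMap.ker δ) = numOrbits {σ, e} := by
    rw [← finrank_invariantFun]
    refine LinearEquiv.finrank_eq
      { toFun := fun g => ⟨g.1.1, ?_⟩
        invFun := fun g => ⟨⟨g.1, ?_⟩, ?_⟩
        left_inv := fun g => rfl
        right_inv := fun g => rfl
        map_add' := fun g h => rfl
        map_smul' := fun c g => rfl }
    · have h1 := (inv_face _).1 g.1.2
      have h2 : ∀ d, g.1.1 (e d) = g.1.1 d := fun d =>
        eq_of _ _ (congrFun (congrArg Subtype.val (LinearMap.mem_ker.1 g.2)) d)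
      refine (inv_two _).2 ⟨fun d => ?_, h2⟩
      have := h1 (σ d)
      rw [h2] at this
      simpa using this.symm
    · have h := (inv_two _).1 g.2
      refine (inv_face _).2 fun d => ?_
      rw [h.2]
      have := h.1 (σ⁻¹ d)
      simpa using this.symm
    · have h := (inv_two _).1 g.2
      rw [LinearMap.mem_ker]
      ext d
      change g.1 d + g.1 (e d) = 0
      rw [h.2, two]
  let B := pairing σ e
  have hBap : ∀ f p, B f p = ∑ d, f.1 d * p.1 d := fun f p => rfl
  have hkerB : Module.finrank (ZMod 2) (LinearMap.ker B.flip) = numOrbits {σ, e} := by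
    rw [← finrank_invariantFun]
    refine LinearEquiv.finrank_eq
      { toFun := fun g => ⟨g.1.1, ?_⟩
        invFun := fun g => ⟨⟨g.1, ?_⟩, ?_⟩
        left_inv := fun g => rfl
        right_inv := fun g => rfl
        map_add' := fun g h => rfl
        map_smul' := fun c g => rfl }
    · refine (inv_two _).2 ⟨(inv_one _ _).1 g.1.2, fun d => eq_of _ _ ?_⟩
      have hm : (Pi.single d 1 + Pi.single (e d) 1 : D → ZMod 2) ∈ invariantFun {e} := by
        refine (inv_one _ _).2 fun x => ?_
        have h1 : e x = d ↔ x = e d := ⟨fun h => by rw [← h, he], fun h => by rw [h, he]⟩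
        simp only [Pi.add_apply, Pi.single_apply, h1, e.apply_eq_iff_eq]
        ring
      have := LinearMap.congr_fun (LinearMap.mem_ker.1 g.2) ⟨_, hm⟩
      change ∑ x, (Pi.single d 1 + Pi.single (e d) 1 : D → ZMod 2) x * g.1.1 x = 0 at this
      simpa [add_mul, Finset.sum_add_distrib, Pi.single_apply] using this
    · exact (inv_one _ _).2 ((inv_two _).1 g.2).1
    · have h := (inv_two _).1 g.2
      rw [LinearMap.mem_ker]
      ext f
      change ∑ x, f.1 x * g.1 x = 0
      have hf := (inv_one _ _).1 f.2
      refine Finset.sum_involution (fun x _ => e x) (fun x _ => ?_) (fun x _ _ => hne x)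
        (fun _ _ => Finset.mem_univ _) (fun x _ => he x)
      rw [hf, h.2, two]
  have hrank : Module.finrank (ZMod 2) (LinearMap.range B.flip) =
      Module.finrank (ZMod 2) (LinearMap.range B) := by
    have hB : B.flip = B.dualMap ∘ₗ Module.Dual.eval (ZMod 2) (invariantFun {σ}) := by
      ext p f
      rfl
    rw [hB, LinearMap.range_comp_of_range_eq_top _ (LinearMap.range_eq_top.2
      (Module.bijective_dual_eval (ZMod 2) _).2), LinearMap.finrank_range_dualMap_eq_finrank_range]
  have n1 := LinearMap.finrank_range_add_finrank_ker δ
  have n2 := LinearMap.finrank_range_add_finrank_ker B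
  have n3 := LinearMap.finrank_range_add_finrank_ker B.flip
  rw [hkerδ, finrank_invariantFun] at n1
  rw [finrank_invariantFun] at n2
  rw [hkerB, finrank_invariantFun, hrank] at n3
  have hle : LinearMap.range δ ≤ LinearMap.ker B := by
    rintro _ ⟨g, rfl⟩
    rw [LinearMap.mem_ker]
    ext p
    have hg := (inv_face _).1 g.2
    have hp := (inv_one _ _).1 p.2
    change ∑ d, (g.1 d + g.1 (e d)) * p.1 d = 0
    have : ∑ d, g.1 (e d) * p.1 d = ∑ d, g.1 d * p.1 d := by
      rw [← Equiv.sum_comp σ]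
      refine Finset.sum_congr rfl fun d _ => ?_
      rw [hp, ← hg (σ d)]
      simp
    simp only [add_mul, Finset.sum_add_distrib, this, two]
  have step : IsPlanarMap σ e ↔ LinearMap.ker B ≤ LinearMap.range δ := by
    constructor
    · intro h
      refine (Submodule.eq_of_le_of_finrank_eq hle ?_).ge
      unfold IsPlanarMap at h
      omega
    · intro h
      have := congrArg (fun W : Submodule _ _ => Module.finrank (ZMod 2) W) (le_antisymm hle h)
      unfold IsPlanarMap
      omega
  rw [step]
  constructor
  · intro h f hf hp
    obtain ⟨g, hg⟩ := h (show (⟨f, (inv_one _ _).2 hf⟩ : invariantFun {e}) ∈ LinearMap.ker B by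
      rw [LinearMap.mem_ker]
      ext p
      exact hp p.1 ((inv_one _ _).1 p.2))
    exact ⟨g.1, (inv_face _).1 g.2, fun d => (congrFun (congrArg Subtype.val hg) d).symm⟩
  · intro h f hf
    obtain ⟨g, hg, hfg⟩ := h f.1 ((inv_one _ _).1 f.2) fun p hp =>
      LinearMap.congr_fun (LinearMap.mem_ker.1 hf) ⟨p, (inv_one _ _).2 hp⟩
    exact ⟨⟨g, (inv_face _).2 hg⟩, by ext d; exact (hfg d).symm⟩

end Planarity

theorem SphericalTangle.glue_planar (S T : SphericalTangle) :
    IsPlanarMap (Dart.rot (S.X ⊕ T.X) ((S.P ⊕ T.P) ⊕ ZMod 4))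
      ((Dart.glue S.X S.P T.X T.P).permCongr (Equiv.sumCongr S.edge T.edge)) := by
  classical
  have : Fintype (Dart S.X S.P) := Fintype.ofFinite _
  have : Fintype (Dart T.X T.P) := Fintype.ofFinite _
  have : Fintype (Dart (S.X ⊕ T.X) ((S.P ⊕ T.P) ⊕ ZMod 4)) := Fintype.ofFinite _
  have two : ∀ a : ZMod 2, a + a = 0 := by decide
  have eq_of : ∀ a b : ZMod 2, a + b = 0 → b = a := by decide
  have hS := (isPlanarMap_iff _ _ S.edge_edge S.edge_ne).1 S.planar
  have hT := (isPlanarMap_iff _ _ T.edge_edge T.edge_ne).1 T.planar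
  set G := Dart.glue S.X S.P T.X T.P with hG
  set e := G.permCongr (Equiv.sumCongr S.edge T.edge) with he
  have e1 : ∀ d, e (G (.inl d)) = G (.inl (S.edge d)) := fun d => by
    simp [he, Equiv.permCongr_apply]
  have e2 : ∀ d, e (G (.inr d)) = G (.inr (T.edge d)) := fun d => by
    simp [he, Equiv.permCongr_apply]
  have ind : ∀ {p : Dart (S.X ⊕ T.X) ((S.P ⊕ T.P) ⊕ ZMod 4) → Prop},
      (∀ d, p (G (.inl d))) → (∀ d, p (G (.inr d))) → ∀ d, p d := by
    intro p h1 h2 d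
    obtain ⟨d, rfl⟩ := G.surjective d
    rcases d with d | d
    exacts [h1 d, h2 d]
  have hsum : ∀ F : Dart (S.X ⊕ T.X) ((S.P ⊕ T.P) ⊕ ZMod 4) → ZMod 2,
      ∑ d, F d = ∑ d, F (G (.inl d)) + ∑ d, F (G (.inr d)) := fun F => by
    rw [← Equiv.sum_comp G, Fintype.sum_sum_type]
  refine (isPlanarMap_iff _ _ (ind (fun d => by simp [e1, S.edge_edge])
    (fun d => by simp [e2, T.edge_edge])) (ind (fun d => by simp [e1, S.edge_ne])
    (fun d => by simp [e2, T.edge_ne]))).2 fun f hf hp => ?_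
  -- the sum of an invariant function over all darts vanishes
  have tot : ∀ (U : SphericalTangle) [Fintype (Dart U.X U.P)] (u : Dart U.X U.P → ZMod 2),
      (∀ d, u (U.edge d) = u d) → ∑ d, u d = 0 := by
    intro U _ u hu
    refine Finset.sum_involution (fun x _ => U.edge x) (fun x _ => ?_) (fun x _ _ => U.edge_ne x)
        (fun _ _ => Finset.mem_univ _) (fun x _ => U.edge_edge x)
    rw [hu, two]
  have f1 : ∀ d, f (G (.inl (S.edge d))) = f (G (.inl d)) := fun d => by rw [← e1, hf]
  have f2 : ∀ d, f (G (.inr (T.edge d))) = f (G (.inr d)) := fun d => by rw [← e2, hf]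
  have const : ∀ u : ZMod 4 → ZMod 2, (∀ j, u (j + 1) = u j) → ∀ j, u j = u 0 := by decide
  -- the restrictions of `f` to the two parts are cycles, hence boundaries
  obtain ⟨g, hg, hfg⟩ := hS (fun d => f (G (.inl d))) f1 fun p hpS => by
    have hc := const (fun j => p (.outer j)) fun j => by
      simpa [Dart.rot] using (hpS (.outer (j + 1))).symm
    have key := hp (fun d => Sum.elim (fun d => p d + p (.outer 0)) (fun _ => 0) (G.symm d)) fun d => by
      match d with
      | .crossing (.inl x) j => exact congrArg (· + p (.outer 0)) (hpS (.crossing x j))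
      | .bead (.inl (.inl x)) b => exact congrArg (· + p (.outer 0)) (hpS (.bead x b))
      | .hole j => exact congrArg (· + p (.outer 0)) (hpS (.hole j))
      | .crossing (.inr x) j => rfl
      | .bead (.inl (.inr x)) b => rfl
      | .outer j => rfl
      | .bead (.inr j) false =>
        change 0 = p (.outer j) + p (.outer 0)
        rw [hc, two]
      | .bead (.inr j) true =>
        change p (.outer j) + p (.outer 0) = 0
        rw [hc, two]
    rw [hsum] at key
    simpa [mul_add, Finset.sum_add_distrib, ← Finset.sum_mul, tot S (fun d => f (G (.inl d))) f1] using key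
  obtain ⟨h, hh, hfh⟩ := hT (fun d => f (G (.inr d))) f2 fun p hpT => by
    have hc := const (fun j => p (.hole j)) fun j => by
      simpa [Dart.rot] using (hpT (.hole j))
    have key := hp (fun d => Sum.elim (fun _ => 0) (fun d => p d + p (.hole 0)) (G.symm d)) fun d => by
      match d with
      | .crossing (.inr x) j => exact congrArg (· + p (.hole 0)) (hpT (.crossing x j))
      | .bead (.inl (.inr x)) b => exact congrArg (· + p (.hole 0)) (hpT (.bead x b))
      | .outer j => exact congrArg (· + p (.hole 0)) (hpT (.outer j))
      | .crossing (.inl x) j => rfl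
      | .bead (.inl (.inl x)) b => rfl
      | .hole j => rfl
      | .bead (.inr j) true =>
        change 0 = p (.hole j) + p (.hole 0)
        rw [hc, two]
      | .bead (.inr j) false =>
        change p (.hole j) + p (.hole 0) = 0
        rw [hc, two]
    rw [hsum] at key
    simpa [mul_add, Finset.sum_add_distrib, ← Finset.sum_mul, tot T (fun d => f (G (.inr d))) f2] using key
  -- the two boundaries agree along the glued points up to a constant
  have hbead : ∀ j, f (G (.inl (.outer j))) = f (G (.inr (.hole j))) := fun j => by
    have := hp (Pi.single (.bead (.inr j) false) 1 + Pi.single (.bead (.inr j) true) 1) fun d => by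
      rcases d with _ | ⟨_, _ | _⟩ | _ | _ <;> simp [Dart.rot, Pi.single_apply]
    simp only [Pi.add_apply, mul_add, Finset.sum_add_distrib, Pi.single_apply, mul_ite, mul_one,
      mul_zero, Finset.sum_ite_eq', Finset.mem_univ, if_true] at this
    exact (eq_of _ _ this).symm
  have ho : ∀ j, g (S.edge (.outer j)) = g (.outer (j + 1)) := fun j => (hg (.outer j)).symm
  have hh' : ∀ j, h (T.edge (.hole j)) = h (.hole (j - 1)) := fun j => (hh (.hole j)).symm
  have hconst := const (fun j => g (.outer j) + h (.hole (j - 1))) fun j => by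
    have h1 := hbead j
    rw [hfg, hfh, ho, hh'] at h1
    have : ∀ a b c d : ZMod 2, a + b = c + d → b + c = a + d := by decide
    simpa using this _ _ _ _ h1
  set c := g (.outer 0) + h (.hole (0 - 1)) with hcdef
  refine ⟨fun d => Sum.elim g (fun d => h d + c) (G.symm d), ?_, ?_⟩
  · have swap : ∀ a b : ZMod 2, a + b = c → b + c = a := by
      intro a b hab
      rw [← hab, add_comm a b, ← add_assoc, two, zero_add]
    refine ind (fun d => ?_) (fun d => ?_)
    · have h1 := hg d
      rw [e1]
      simp only [Equiv.symm_apply_apply, Sum.elim_inl]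
      rw [← h1]
      match d with
      | .crossing x j => rfl
      | .bead x b => rfl
      | .hole j => rfl
      | .outer j =>
        change h (.hole j) + c = g (.outer (j + 1))
        exact swap _ _ (by simpa using hconst (j + 1))
    · have h1 := hh d
      rw [e2]
      simp only [Equiv.symm_apply_apply, Sum.elim_inr]
      rw [← h1]
      match d with
      | .crossing x j => rfl
      | .bead x b => rfl
      | .outer j => rfl
      | .hole j =>
        change g (.outer j) = h (.hole (j - 1)) + c
        exact (swap _ _ (hconst j)).symm
  · refine ind (fun d => ?_) (fun d => ?_)
    · simp [e1, hfg]
    · have : ∀ a b c : ZMod 2, a + b = a + c + (b + c) := by decide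
      simp [e2, hfh, ← this]

/-- The diagram `S₂(S₁)`: the hole of `S₂` is filled with `S₁`. -/
def SphericalTangle.comp (S₂ S₁ : SphericalTangle) : SphericalTangle where
  X := S₁.X ⊕ S₂.X
  P := (S₁.P ⊕ S₂.P) ⊕ ZMod 4
  edge := (Dart.glue S₁.X S₁.P S₂.X S₂.P).permCongr (Equiv.sumCongr S₁.edge S₂.edge)
  edge_edge d := by
    obtain ⟨d | d, rfl⟩ := (Dart.glue S₁.X S₁.P S₂.X S₂.P).surjective d <;>
      simp [Equiv.permCongr_apply, SphericalTangle.edge_edge]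
  edge_ne d := by
    obtain ⟨d | d, rfl⟩ := (Dart.glue S₁.X S₁.P S₂.X S₂.P).surjective d <;>
      simp [Equiv.permCongr_apply, SphericalTangle.edge_ne]
  planar := SphericalTangle.glue_planar S₁ S₂

/-! ### The invariant -/

/-- The joining of the darts at each vertex in the resolution of a closure. At a crossing, `true`
is the `A`-type splitting, which joins the two regions swept by the over-strand when it is turned
counterclockwise, and `false` is the `B`-type splitting. For `k = 0` the outer endpoints are joined
as in the numerator closure (north-west with north-east, south-west with south-east), for `k = 1` as
in the denominator closure (north-west with south-west, north-east with south-east). For `j = 0` the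
hole is filled with the first fundamental tangle (two vertical arcs, whose numerator closure is a
single circle), for `j = 1` with the second one (two horizontal arcs, whose denominator closure is a
single circle). -/
def Dart.join {X P : Type} (s : X → Bool) (k j : Fin 2) : Equiv.Perm (Dart X P) :=
  Function.Involutive.toPerm
    (fun
      | crossing x i => crossing x (if s x then 3 - i else 1 - i)
      | bead p b => bead p (!b)
      | outer i => outer (if k = 0 then 3 - i else 1 - i)
      | hole i => hole (if j = 0 then 1 - i else 3 - i))
    (by intro d; cases d <;> simp <;> split_ifs <;> simp)

namespace SphericalTangle

/-- The number of circles in the resolution, by the state `s`, of the link diagram obtained from `S`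
by taking the closure `k` and filling the hole with the fundamental tangle `j`. -/
def circles (S : SphericalTangle) (k j : Fin 2) (s : S.X → Bool) : ℕ :=
  numOrbits {S.edge, Dart.join s k j}

/-- The Kauffman bracket, at `A`, of the link diagram obtained from `S` by taking the closure `k`
and filling the hole with the fundamental tangle `j`: the sum over all states. -/
def bracket (A : ℂ) (S : SphericalTangle) (k j : Fin 2) : ℂ :=
  ∑ s : S.X → Bool, A ^ (Finset.univ.filter fun x => s x = true).card *
    A⁻¹ ^ (Finset.univ.filter fun x => s x = false).card *
    (-A ^ 2 - A⁻¹ ^ 2) ^ (S.circles k j s - 1)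

open Complex in
/-- The set of all integer matrices of the form
`z⟨S₁₍₁₎⟩, (-i)z⟨S₁₍₂₎⟩; iz⟨S₂₍₁₎⟩, (-i)iz⟨S₂₍₂₎⟩` with `z` an eighth root of unity, where the
brackets are taken at `A = exp(iπ/4)`. -/
def F (S : SphericalTangle) : Set (Matrix (Fin 2) (Fin 2) ℤ) :=
  {M | ∃ z : ℂ, z ^ 8 = 1 ∧ ∀ k j : Fin 2,
    (M k j : ℂ) = (-I) ^ (j : ℕ) * I ^ (k : ℕ) * z * S.bracket (exp (I * Real.pi / 4)) k j}

end SphericalTangle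

/-! ### Matrices modulo sign -/

/-- Matrices that are equal up to sign. -/
def signSetoid (m n : ℕ) : Setoid (Matrix (Fin m) (Fin n) ℤ) where
  r M N := M = N ∨ M = -N
  iseqv :=
    { refl := fun _ => .inl rfl
      symm := by
        rintro _ _ (rfl | rfl)
        exacts [.inl rfl, .inr (neg_neg _).symm]
      trans := by
        rintro _ _ _ (rfl | rfl) (rfl | rfl)
        exacts [.inl rfl, .inr rfl, .inr rfl, .inl (neg_neg _)] }

/-- `PM m n` is the quotient of the integer `m × n` matrices under multiplication by `±1`. -/
def PM (m n : ℕ) : Type := Quotient (signSetoid m n)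

namespace PM

/-- The class of a matrix. -/
def mk {m n : ℕ} (M : Matrix (Fin m) (Fin n) ℤ) : PM m n := Quotient.mk (signSetoid m n) M

/-- The class `{M, -M}` as a set of matrices. -/
def carrier {m n : ℕ} (a : PM m n) : Set (Matrix (Fin m) (Fin n) ℤ) := {M | mk M = a}

/-- The product `[M][N] = [MN]`. -/
def mul {l m n : ℕ} : PM l m → PM m n → PM l n :=
  Quotient.map₂ (fun M N => M * N) (by
    rintro _ _ (rfl | rfl) _ _ (rfl | rfl)
    exacts [.inl rfl, .inr (Matrix.mul_neg _ _), .inr (Matrix.neg_mul _ _),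
      .inl (by rw [Matrix.neg_mul, Matrix.mul_neg, neg_neg])])

end PM

end

open Equiv

/-! ### Counting cycles -/

/-! At `A = exp(iπ/4)` one has `A² = i`, so a circle has value `-A² - A⁻² = 0` and the bracket only
sees the states with exactly one circle. A state with `β` splittings of type `B`, out of `n`
crossings, has weight `Aⁿ(-i)^β`. Two facts about one-circle states carry the theorem.

Parity (`circles_parity`): by planarity the regions have a checkerboard colouring, so each circle
alternates in colour and corresponds to one cycle of a permutation of the darts of colour `0`.
Changing one splitting, the closure or the filling multiplies this permutation by a transposition,
and a comparison of signs shows that the number of circles changes parity. Hence `β` modulo 2 is the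
same for all one-circle states with given `k`, `j`, and depends on `k + j` only up to a constant.
The four brackets therefore become integers after the prescribed powers of `i` and a common eighth
root of unity are inserted (`exists_bracket_eq`, `exists_mem_F`). The matrix is unique up to sign
because a real eighth root of unity is `±1` (`F_eq_carrier`).

Gluing (`comp_circles_indicator`): with its four ends left loose, a state joins them in neighbouring
pairs, in one of two ways (`exists_sidePairing`). Gluing two states yields a single circle exactly
when neither part has a circle that misses the glued points and the two pairings differ. The same
data decide which fillings and closures of the parts give one circle, so the indicator of a single
circle is multiplicative as a 2×2 matrix. Summing over states makes the bracket matrix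
multiplicative (`comp_bracket`), and the powers of `i` in `F` amount to conjugation by `diag(1, i)`.
-/

theorem numOrbits_singleton {D : Type} [Fintype D] [DecidableEq D] (τ : Perm D) :
    numOrbits {τ} = Multiset.card τ.cycleType + (Fintype.card D - τ.support.card) := by
  classical
  -- The fibres of this map are the orbits: a moved point goes to its cycle, a fixed point to
  -- itself.
  let φ : D → τ.cycleFactorsFinset ⊕ {d // d ∉ τ.support} := fun d =>
    if h : d ∈ τ.support then .inl ⟨τ.cycleOf d, Perm.cycleOf_mem_cycleFactorsFinset_iff.2 h⟩
    else .inr ⟨d, h⟩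
  have hφ : Function.Surjective φ := by
    rintro (⟨c, hc⟩ | ⟨d, hd⟩)
    · have hcyc := (Perm.mem_cycleFactorsFinset_iff.1 hc).1
      obtain ⟨a, ha⟩ := hcyc.nonempty_support
      have h : c = τ.cycleOf a := Perm.cycle_is_cycleOf ha hc
      have ha' : a ∈ τ.support := Perm.mem_cycleFactorsFinset_support_le hc ha
      exact ⟨a, by simp only [φ, dif_pos ha', h]⟩
    · exact ⟨d, by simp only [φ, dif_neg hd]⟩
  have hrel : ∀ x y, φ x = φ y ↔ τ.SameCycle x y := by
    intro x y
    by_cases hx : x ∈ τ.support <;> by_cases hy : y ∈ τ.support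
    · simp only [φ, dif_pos hx, dif_pos hy, Sum.inl.injEq, Subtype.mk.injEq]
      exact (Perm.sameCycle_iff_cycleOf_eq_of_mem_support hx hy).symm
    · simp only [φ, dif_pos hx, dif_neg hy, reduceCtorEq, false_iff]
      exact fun h => Perm.mem_support.1 hx (h.apply_eq_self_iff.2 (Perm.notMem_support.1 hy))
    · simp only [φ, dif_neg hx, dif_pos hy, reduceCtorEq, false_iff]
      exact fun h => Perm.mem_support.1 hy (h.apply_eq_self_iff.1 (Perm.notMem_support.1 hx))
    · simp only [φ, dif_neg hx, dif_neg hy, Sum.inr.injEq, Subtype.mk.injEq]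
      refine ⟨fun h => h ▸ Perm.SameCycle.refl _ _, fun h => ?_⟩
      obtain ⟨n, rfl⟩ := h
      exact (Perm.zpow_apply_eq_self_of_apply_eq_self (Perm.notMem_support.1 hx) n).symm
  have hset : MulAction.orbitRel (Subgroup.closure {τ}) D = Setoid.ker φ := by
    ext x y
    rw [Setoid.ker_def, hrel, MulAction.orbitRel_apply, Perm.sameCycle_comm]
    constructor
    · rintro ⟨⟨s, hs⟩, rfl⟩
      obtain ⟨n, rfl⟩ := Subgroup.mem_closure_singleton.1 hs
      exact ⟨n, rfl⟩
    · rintro ⟨n, rfl⟩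
      exact ⟨⟨τ ^ n, Subgroup.mem_closure_singleton.2 ⟨n, rfl⟩⟩, rfl⟩
  rw [numOrbits, MulAction.orbitRel.Quotient, hset,
    Nat.card_congr (Setoid.quotientKerEquivOfSurjective φ hφ), Nat.card_sum]
  congr 1
  · rw [Nat.card_eq_fintype_card, Fintype.card_coe, Perm.cycleType_def, Multiset.card_map]
    rfl
  · rw [Nat.card_eq_fintype_card, Fintype.card_subtype_compl, Fintype.card_coe]

/-- A cycle of length `l` has sign `(-1)^(l+1)`. Fixed points enter the exponent twice, once as
points and once as orbits, and so do not matter. -/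
theorem sign_eq_neg_one_pow_numOrbits {D : Type} [Fintype D] [DecidableEq D] (τ : Perm D) :
    Perm.sign τ = (-1) ^ (Fintype.card D + numOrbits {τ}) := by
  rw [Perm.sign_of_cycleType, Perm.sum_cycleType, numOrbits_singleton]
  have h : τ.support.card ≤ Fintype.card D := Finset.card_le_univ _
  rw [show Fintype.card D + (Multiset.card τ.cycleType + (Fintype.card D - τ.support.card)) =
    τ.support.card + Multiset.card τ.cycleType +
      2 * (Fintype.card D - τ.support.card) by omega, pow_add _ _ (2 * _), pow_mul]
  simp

/-! ### Circles formed by two alternating involutions -/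

theorem mem_invariantFun_pair {D : Type} {e t : Perm D} {f : D → ZMod 2} :
    f ∈ invariantFun {e, t} ↔ (∀ d, f (e d) = f d) ∧ ∀ d, f (t d) = f d := by
  refine ⟨fun h => ⟨h e (by simp), h t (by simp)⟩, ?_⟩
  rintro ⟨h1, h2⟩ s (rfl | rfl)
  exacts [h1, h2]

theorem add_one_add_one_zmod_two (a : ZMod 2) : a + 1 + 1 = a := by decide +revert

/-- A permutation restricted to the elements of colour `0`, where both `e` and `t` exchange the
colours. -/
def zeroPerm {D : Type} (g : D → ZMod 2) (e t : Perm D) (he : ∀ d, g (e d) = g d + 1)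
    (ht : ∀ d, g (t d) = g d + 1) : Perm {d // g d = 0} :=
  (t * e).subtypePerm fun d => by
    rw [Perm.mul_apply, ht, he, add_one_add_one_zmod_two]

/-- Along a circle `e` and `t` alternate and so do the colours, so the points of colour `0` on it
form one cycle of `t * e`. The proof compares dimensions of spaces of invariant functions: such a
function is determined by its values on colour `0`, and extends to colour `1` along `e`. -/
theorem numOrbits_zeroPerm {D : Type} [Finite D] (g : D → ZMod 2) (e t : Perm D)
    (he : ∀ d, g (e d) = g d + 1) (ht : ∀ d, g (t d) = g d + 1)
    (hee : ∀ d, e (e d) = d) (htt : ∀ d, t (t d) = d) :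
    numOrbits {zeroPerm g e t he ht} = numOrbits {e, t} := by
  classical
  have ne_zero : ∀ a : ZMod 2, ¬ a = 0 ↔ a + 1 = 0 := by decide
  have he0 : ∀ d, ¬ g d = 0 → g (e d) = 0 := fun d h => by rw [he]; exact (ne_zero _).1 h
  have he1 : ∀ d, g d = 0 → ¬ g (e d) = 0 := fun d h => by rw [he, h]; decide
  have ht1 : ∀ d, g d = 0 → ¬ g (t d) = 0 := fun d h => by rw [ht, h]; decide
  have ht0 : ∀ d, ¬ g d = 0 → g (t d) = 0 := fun d h => by rw [ht]; exact (ne_zero _).1 h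
  rw [← finrank_invariantFun, ← finrank_invariantFun]
  refine LinearEquiv.finrank_eq
    { toFun := fun h => ⟨fun d => if hd : g d = 0 then h.1 ⟨d, hd⟩ else h.1 ⟨e d, he0 d hd⟩, ?_⟩
      invFun := fun f => ⟨fun d => f.1 d.1, ?_⟩
      left_inv := fun h => by
        ext d
        simp [d.2]
      right_inv := fun f => by
        ext d
        by_cases hd : g d = 0
        · simp [hd]
        · simpa [hd] using (mem_invariantFun_pair.1 f.2).1 d
      map_add' := fun h k => by
        ext d
        by_cases hd : g d = 0 <;> simp [hd]
      map_smul' := fun c h => by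
        ext d
        by_cases hd : g d = 0 <;> simp [hd] }
  · have hh : ∀ d (hd : g d = 0), h.1 ⟨t (e d), ht0 _ (he1 d hd)⟩ = h.1 ⟨d, hd⟩ :=
      fun d hd => h.2 _ rfl ⟨d, hd⟩
    refine mem_invariantFun_pair.2 ⟨fun d => ?_, fun d => ?_⟩
    · by_cases hd : g d = 0
      · simp [hd, he1 d hd, hee]
      · simp [hd, he0 d hd]
    · by_cases hd : g d = 0
      · simp only [hd, ht1 d hd, dite_true, dite_false]
        rw [← hh (e (t d)) (he0 _ (ht1 d hd))]
        simp only [hee, htt]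
      · simp only [hd, ht0 d hd, dite_true, dite_false]
        rw [← hh (e d) (he0 d hd)]
        simp only [hee]
  · rintro s rfl d
    have hf := mem_invariantFun_pair.1 f.2
    change f.1 (t (e d)) = f.1 d
    rw [hf.2, hf.1]

/-- Joining four alternately coloured points the other way changes the parity of the number
of circles. -/
theorem odd_numOrbits_add_numOrbits {D : Type} [Finite D] (g : D → ZMod 2) (e t t' : Perm D)
    (he : ∀ d, g (e d) = g d + 1) (ht : ∀ d, g (t d) = g d + 1) (ht' : ∀ d, g (t' d) = g d + 1)
    (hee : ∀ d, e (e d) = d) (htt : ∀ d, t (t d) = d) (htt' : ∀ d, t' (t' d) = d)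
    (o : ZMod 4 → D) (ho : Function.Injective o) (hto : ∀ i, t (o i) = o (3 - i))
    (hto' : ∀ i, t' (o i) = o (1 - i)) (h : ∀ d, d ∉ Set.range o → t' d = t d) :
    Odd (numOrbits {e, t} + numOrbits {e, t'}) := by
  classical
  have := Fintype.ofFinite D
  have hgo : ∀ i, g (o (3 - i)) = g (o i) + 1 := fun i => by rw [← hto, ht]
  have hgo' : ∀ i, g (o (1 - i)) = g (o i) + 1 := fun i => by rw [← hto', ht']
  have h03 := hgo 0
  have h12 := hgo 1
  have h01 := hgo' 0
  rw [show (3 : ZMod 4) - 0 = 3 by decide] at h03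
  rw [show (3 : ZMod 4) - 1 = 2 by decide] at h12
  rw [show (1 : ZMod 4) - 0 = 1 by decide] at h01
  rw [h01, add_one_add_one_zmod_two] at h12
  -- the two points of colour zero
  obtain ⟨j, hj0, hj2, hj⟩ : ∃ j : ZMod 4, g (o j) = 0 ∧ g (o (j + 2)) = 0 ∧
      ∀ i, g (o i) = 0 → i = j ∨ i = j + 2 := by
    have z : ∀ a : ZMod 2, a = 0 ∨ a = 1 := by decide
    have cases4 : ∀ i : ZMod 4, i = 0 ∨ i = 1 ∨ i = 2 ∨ i = 3 := by decide
    rcases z (g (o 0)) with h0 | h0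
    · refine ⟨0, h0, h12.trans h0, fun i hi => ?_⟩
      rcases cases4 i with rfl | rfl | rfl | rfl
      · simp
      · rw [h01, h0] at hi; exact absurd hi (by decide)
      · simp
      · rw [h03, h0] at hi; exact absurd hi (by decide)
    · refine ⟨1, by rw [h01, h0]; decide, ?_, fun i hi => ?_⟩
      · rw [show (1 : ZMod 4) + 2 = 3 by decide, h03, h0]; decide
      rcases cases4 i with rfl | rfl | rfl | rfl
      · rw [h0] at hi; exact absurd hi (by decide)
      · simp
      · rw [h12, h0] at hi; exact absurd hi (by decide)
      · right; decide
  have hne : (⟨o j, hj0⟩ : {d // g d = 0}) ≠ ⟨o (j + 2), hj2⟩ := fun hc => by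
    have e3 : ∀ i : ZMod 4, i ≠ i + 2 := by decide
    exact e3 j (ho (congrArg Subtype.val hc))
  -- Re-pairing the marked points only exchanges the two marked targets of colour `0`, since `1 - i
  -- = (3 - i) + 2`.
  have hswap : zeroPerm g e t' he ht' =
      swap ⟨o j, hj0⟩ ⟨o (j + 2), hj2⟩ * zeroPerm g e t he ht := by
    have key : ∀ d, ∀ hd : g (t d) = 0, t' d =
        (swap (⟨o j, hj0⟩ : {d // g d = 0}) ⟨o (j + 2), hj2⟩ ⟨t d, hd⟩).1 := by
      intro d hd
      by_cases hr : d ∈ Set.range o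
      · obtain ⟨i, rfl⟩ := hr
        have e1 : ∀ i : ZMod 4, 1 - i = 3 - i + 2 := by decide
        have e2 : ∀ i : ZMod 4, i + 2 + 2 = i := by decide
        rw [hto' i, e1]
        simp only [hto] at hd ⊢
        rcases hj _ hd with h3 | h3
        · simp only [h3, swap_apply_left]
        · simp only [h3, swap_apply_right, e2]
      · have hnr : ∀ i, t d ≠ o i := fun i hi => hr ⟨3 - i, by rw [← hto, ← hi, htt]⟩
        rw [h d hr, swap_apply_of_ne_of_ne]
        · exact fun hc => hnr _ (congrArg Subtype.val hc)
        · exact fun hc => hnr _ (congrArg Subtype.val hc)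
    ext d
    exact key (e d.1) (zeroPerm g e t he ht d).2
  have hs := congrArg Perm.sign hswap
  rw [Perm.sign_mul, Perm.sign_swap hne, sign_eq_neg_one_pow_numOrbits,
    sign_eq_neg_one_pow_numOrbits, numOrbits_zeroPerm _ _ _ _ _ hee htt,
    numOrbits_zeroPerm _ _ _ _ _ hee htt', pow_add, pow_add, mul_left_comm, mul_right_inj] at hs
  rcases Nat.even_or_odd (numOrbits {e, t}) with h1 | h1 <;>
    rcases Nat.even_or_odd (numOrbits {e, t'}) with h2 | h2
  · rw [h1.neg_one_pow, h2.neg_one_pow] at hs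
    exact absurd hs (by decide)
  · exact h1.add_odd h2
  · exact h1.add_even h2
  · rw [h1.neg_one_pow, h2.neg_one_pow] at hs
    exact absurd hs (by decide)

/-! ### Four marked points -/

/-- The number of circles is the dimension of the space of invariant functions, which always
contains the line of constants. -/
theorem numOrbits_pair_eq_one_iff {D : Type} [Finite D] [Nonempty D] (e t : Perm D) :
    numOrbits {e, t} = 1 ↔
      ∀ f : D → ZMod 2, (∀ d, f (e d) = f d) → (∀ d, f (t d) = f d) → ∀ x y, f x = f y := by
  rw [← finrank_invariantFun]
  have hv : (⟨fun _ => 1, mem_invariantFun_pair.2 ⟨fun _ => rfl, fun _ => rfl⟩⟩ :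
      invariantFun {e, t}) ≠ 0 := fun h => by
    have := congrFun (congrArg Subtype.val h) (Classical.arbitrary D)
    exact absurd this (by simp)
  rw [finrank_eq_one_iff_of_nonzero' _ hv]
  constructor
  · intro h f h1 h2 x y
    obtain ⟨c, hc⟩ := h ⟨f, mem_invariantFun_pair.2 ⟨h1, h2⟩⟩
    have := fun z => congrFun (congrArg Subtype.val hc) z
    exact (this x).symm.trans (this y)
  · intro h f
    have hf := mem_invariantFun_pair.1 f.2
    refine ⟨f.1 (Classical.arbitrary D), ?_⟩
    ext d
    simpa using h f.1 hf.1 hf.2 _ d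

/-- The two ways to join neighbours among four cyclically ordered points. -/
def sidePairing (a : Fin 2) (i : ZMod 4) : ZMod 4 := if a = 0 then 3 - i else 1 - i

/-- The indicator function of the pair of the point `0`. -/
def sideIndicator (a : Fin 2) (i : ZMod 4) : ZMod 2 := if i = 0 ∨ i = sidePairing a 0 then 1 else 0

/-- The two pairings together connect all four points in a cycle. -/
theorem add_eq_zero_of_sidePairing : ∀ (a b : Fin 2), b ≠ a → ∀ u : ZMod 4 → ZMod 2,
    (∀ i, u (sidePairing a i) = u i) → (∀ i, u (sidePairing b i) = u i) →
    ∀ i, u i + u 0 = 0 := by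
  decide

theorem sideIndicator_two_ne_zero : ∀ a, sideIndicator a 2 ≠ sideIndicator a 0 := by decide

set_option synthInstance.maxHeartbeats 200000 in
set_option synthInstance.maxSize 100000 in
-- Functions of sum zero are spanned by `1` and the indicators of the two pairings. If the indicator
-- of `b` occurred in `u`, cancelling that of `a` by a suitable `c` would leave a `b`-invariant
-- function that separates `0` from `2`.
theorem sidePairing_eq_of_sum_eq_zero : ∀ (a b : Fin 2), a ≠ b → ∀ u : ZMod 4 → ZMod 2,
    ∑ i, u i = 0 →
    (∀ c, (∀ i, u (sidePairing b i) + c * sideIndicator a (sidePairing b i) =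
      u i + c * sideIndicator a i) →
      u 0 + c * sideIndicator a 0 = u 2 + c * sideIndicator a 2) →
    ∀ i, u (sidePairing a i) = u i := by
  decide

/-- Functions that are constant along the arcs formed by `e` and `t`, where the marked points `o`
are left loose. -/
structure IsLoose {D : Type} (e t : Perm D) (o : ZMod 4 → D) (f : D → ZMod 2) : Prop where
  edge : ∀ d, f (e d) = f d
  join : ∀ d, d ∉ Set.range o → f (t d) = f d

namespace IsLoose

variable {D : Type} {e t : Perm D} {o : ZMod 4 → D} {f h : D → ZMod 2}

theorem add (hf : IsLoose e t o f) (hh : IsLoose e t o h) :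
    IsLoose e t o fun d => f d + h d :=
  ⟨fun d => by rw [hf.edge, hh.edge], fun d hd => by rw [hf.join d hd, hh.join d hd]⟩

theorem const (c : ZMod 2) : IsLoose e t o fun _ => c := ⟨fun _ => rfl, fun _ _ => rfl⟩

theorem mul_const (c : ZMod 2) (hf : IsLoose e t o f) : IsLoose e t o fun d => c * f d :=
  ⟨fun d => by rw [hf.edge], fun d hd => by rw [hf.join d hd]⟩

/-- The sum over all points cancels in pairs along `e`, and the sum over the unmarked points cancels
in pairs along `t`. -/
theorem sum_marked [Finite D] (hf : IsLoose e t o f) (hee : ∀ d, e (e d) = d)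
    (htt : ∀ d, t (t d) = d) (hen : ∀ d, e d ≠ d) (htn : ∀ d, t d ≠ d)
    (ho : Function.Injective o) (ht : ∀ i, t (o i) ∈ Set.range o) : ∑ i, f (o i) = 0 := by
  classical
  have := Fintype.ofFinite D
  have two : ∀ a : ZMod 2, a + a = 0 := by decide
  have h1 : ∑ d, f d = 0 :=
    Finset.sum_involution (fun x _ => e x) (fun x _ => by rw [hf.edge, two]) (fun x _ _ => hen x)
      (fun _ _ => Finset.mem_univ _) fun x _ => hee x
  have h2 : ∑ d ∈ (Finset.univ.image o)ᶜ, f d = 0 := by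
    refine Finset.sum_involution (fun x _ => t x) (fun x hx => ?_) (fun x _ _ => htn x)
      (fun x hx => ?_) fun x _ => htt x
    · rw [hf.join x (by simpa using hx), two]
    · simp only [Finset.mem_compl, Finset.mem_image, Finset.mem_univ, true_and] at hx ⊢
      rintro ⟨i, hi⟩
      obtain ⟨j, hj⟩ := ht i
      exact hx ⟨j, by rw [hj, hi, htt]⟩
  rw [← Finset.sum_add_sum_compl (Finset.univ.image o), h2, add_zero,
    Finset.sum_image fun _ _ _ _ h => ho h] at h1
  exact h1

end IsLoose

/-- Four loose ends of alternating colours are joined in neighbouring pairs, and only one of the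
two closures can produce a single circle. -/
theorem exists_sidePairing {D : Type} [Finite D] (g : D → ZMod 2) (e : Perm D)
    (t : Fin 2 → Perm D) (he : ∀ d, g (e d) = g d + 1) (ht : ∀ l d, g (t l d) = g d + 1)
    (hee : ∀ d, e (e d) = d) (htt : ∀ l d, t l (t l d) = d)
    (o : ZMod 4 → D) (ho : Function.Injective o) (hto : ∀ l i, t l (o i) = o (sidePairing l i))
    (hoff : ∀ l d, d ∉ Set.range o → t l d = t 0 d) :
    ∃ a, (∀ f, IsLoose e (t 0) o f → ∀ i, f (o (sidePairing a i)) = f (o i)) ∧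
      (∃ h, IsLoose e (t 0) o h ∧ ∀ i, h (o i) = sideIndicator a i) ∧
      ∀ l, numOrbits {e, t l} = 1 ↔
        (∀ f, IsLoose e (t 0) o f → (∀ i, f (o i) = 0) → ∀ d, f d = 0) ∧ l ≠ a := by
  classical
  have self_ne : ∀ a : ZMod 2, a + 1 ≠ a := by decide
  have two : ∀ a b : ZMod 2, a + b = 0 ↔ a = b := by decide
  have mem : ∀ l f, f ∈ invariantFun {e, t l} ↔
      IsLoose e (t 0) o f ∧ ∀ i, f (o (sidePairing l i)) = f (o i) := by
    intro l f
    rw [mem_invariantFun_pair]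
    refine ⟨fun ⟨h1, h2⟩ => ⟨⟨h1, fun d hd => by rw [← hoff l d hd, h2]⟩,
      fun i => by rw [← hto, h2]⟩, fun ⟨h1, h2⟩ => ⟨h1.edge, fun d => ?_⟩⟩
    by_cases hd : d ∈ Set.range o
    · obtain ⟨i, rfl⟩ := hd
      rw [hto, h2]
    · rw [hoff l d hd, h1.join d hd]
  have four : ∀ i : ZMod 4, i = 0 ∨ i = 1 ∨ i = 2 ∨ i = 3 := by decide
  have pair_const : ∀ l (u : ZMod 4 → ZMod 2), (∀ i, u (sidePairing l i) = u i) → u 0 = u 2 →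
      ∀ i, u i = u 0 := by
    intro l u h1 h2 i
    have a0 := h1 0
    have a2 := h1 2
    fin_cases l
    · rw [show sidePairing _ 0 = 3 by decide] at a0
      rw [show sidePairing _ 2 = 1 by decide] at a2
      rcases four i with rfl | rfl | rfl | rfl <;> simp [*]
    · rw [show sidePairing _ 0 = 1 by decide] at a0
      rw [show sidePairing _ 2 = 3 by decide] at a2
      rcases four i with rfl | rfl | rfl | rfl <;> simp [*]
  -- exactly one closure admits an invariant function that separates the pairs
  let P : Fin 2 → Prop := fun l => ∃ f ∈ invariantFun {e, t l}, f (o 0) ≠ f (o 2)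
  -- The functional `f ↦ f (o 0) + f (o 2)` has as kernel the functions that are constant on the
  -- marked points, and these are invariant for both closures. The two circle counts thus differ
  -- from a common number by `0` or `1`, and as their sum is odd, `P` holds for exactly one closure.
  have hrank : ∀ l, Module.finrank (ZMod 2) (invariantFun {e, t l}) = (if P l then 1 else 0) +
      Module.finrank (ZMod 2) ↥(invariantFun {e, t 0} ⊓ invariantFun {e, t 1}) := by
    intro l
    let ψ : invariantFun {e, t l} →ₗ[ZMod 2] ZMod 2 :=
      { toFun := fun f => f.1 (o 0) + f.1 (o 2)
        map_add' := fun f h => by simp; ring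
        map_smul' := fun c f => by simp; ring }
    have hker : (LinearMap.ker ψ).map (invariantFun {e, t l}).subtype =
        invariantFun {e, t 0} ⊓ invariantFun {e, t 1} := by
      ext f
      rw [Submodule.mem_map, Submodule.mem_inf]
      constructor
      · rintro ⟨f, hf, rfl⟩
        have h1 := (mem l _).1 f.2
        have h2 := pair_const l (fun i => f.1 (o i)) h1.2 ((two _ _).1 hf)
        exact ⟨(mem _ _).2 ⟨h1.1, fun i => (h2 _).trans (h2 i).symm⟩,
          (mem _ _).2 ⟨h1.1, fun i => (h2 _).trans (h2 i).symm⟩⟩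
      · rintro ⟨h0, h1⟩
        have hl : f ∈ invariantFun {e, t l} := by
          fin_cases l
          exacts [h0, h1]
        refine ⟨⟨f, hl⟩, (two _ _).2 ?_, rfl⟩
        exact (((mem _ _).1 h0).2 0).symm.trans (((mem _ _).1 h1).2 2)
    rw [← hker, Submodule.finrank_map_subtype_eq, ← LinearMap.finrank_range_add_finrank_ker ψ]
    congr 1
    split_ifs with h
    · obtain ⟨f, hf, hne⟩ := h
      have : LinearMap.range ψ = ⊤ := LinearMap.range_eq_top.2 <|
        LinearMap.surjective (f := ψ) fun h0 => hne ((two _ _).1 (LinearMap.congr_fun h0 ⟨f, hf⟩))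
      rw [this, finrank_top, Module.finrank_self]
    · have : ψ = 0 := by
        ext f
        by_contra hc
        exact h ⟨f.1, f.2, fun h0 => hc ((two _ _).2 h0)⟩
      rw [this, LinearMap.range_zero, finrank_bot]
  have hodd := odd_numOrbits_add_numOrbits g e (t 0) (t 1) he (ht 0) (ht 1) hee (htt 0) (htt 1)
    o ho (hto 0) (hto 1) (hoff 1)
  rw [← finrank_invariantFun, ← finrank_invariantFun, hrank 0, hrank 1] at hodd
  obtain ⟨a, b, hab, ⟨h, hh, hne⟩, hb⟩ : ∃ a b : Fin 2, a ≠ b ∧ P a ∧ ¬ P b := by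
    by_cases h0 : P 0 <;> by_cases h1 : P 1
    · exact absurd hodd (by rw [if_pos h0, if_pos h1, Nat.not_odd_iff_even]; simp [parity_simps])
    · exact ⟨0, 1, by decide, h0, h1⟩
    · exact ⟨1, 0, by decide, h1, h0⟩
    · exact absurd hodd (by rw [if_neg h0, if_neg h1, Nat.not_odd_iff_even]; simp [parity_simps])
  have hha := (mem _ _).1 hh
  have indicator_of : ∀ u : ZMod 4 → ZMod 2, (∀ i, u (sidePairing a i) = u i) → u 0 ≠ u 2 →
      ∀ i, u i + u 2 = sideIndicator a i := by
    clear * -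
    decide +revert
  have hk := indicator_of (fun i => h (o i)) hha.2 hne
  have hkl : IsLoose e (t 0) o fun d => h d + h (o 2) := hha.1.add (.const _)
  -- Adding a constant normalises the separating function to vanish at `o 2`, which makes it the
  -- indicator of one pair of ends.
  set k := fun d => h d + h (o 2) with hkdef
  replace hk : ∀ i, k (o i) = sideIndicator a i := hk
  have hsum := fun f (hf : IsLoose e (t 0) o f) => hf.sum_marked hee (htt 0)
    (fun d hd => self_ne _ ((he d).symm.trans (congrArg g hd)))
    (fun d hd => self_ne _ ((ht 0 d).symm.trans (congrArg g hd))) ho fun i => ⟨_, (hto 0 i).symm⟩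
  have hpair : ∀ f, IsLoose e (t 0) o f → ∀ i, f (o (sidePairing a i)) = f (o i) := by
    intro f hf
    have key : ∀ c, (∀ i, (fun d => f d + c * k d) (o (sidePairing b i)) =
        (fun d => f d + c * k d) (o i)) → f (o 0) + c * k (o 0) = f (o 2) + c * k (o 2) := by
      intro c hc
      by_contra hn
      exact hb ⟨_, (mem _ _).2 ⟨hf.add (hkl.mul_const c), hc⟩, hn⟩
    refine sidePairing_eq_of_sum_eq_zero a b hab (fun i => f (o i)) (hsum f hf) fun c hc => ?_
    simp only [hk] at key
    exact key c hc
  refine ⟨a, hpair, ⟨k, hkl, hk⟩, fun l => ?_⟩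
  have : Nonempty D := ⟨o 0⟩
  rw [numOrbits_pair_eq_one_iff]
  constructor
  · intro hconst
    refine ⟨fun f hf h0 d => ?_, ?_⟩
    · have hm := mem_invariantFun_pair.1 ((mem l f).2 ⟨hf, fun i => by rw [h0, h0]⟩)
      rw [hconst f hm.1 hm.2 d (o 0), h0]
    · rintro rfl
      have hm := mem_invariantFun_pair.1 hh
      exact hne (hconst h hm.1 hm.2 _ _)
  · rintro ⟨hz, hl⟩ f h1 h2
    have hm := (mem l f).1 (mem_invariantFun_pair.2 ⟨h1, h2⟩)
    have hc := hz _ (hm.1.add (.const (f (o 0))))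
      (add_eq_zero_of_sidePairing a l hl (fun i => f (o i)) (hpair f hm.1) hm.2)
    intro x y
    rw [(two _ _).1 (hc x), (two _ _).1 (hc y)]

/-- A function that is constant along circles after gluing amounts to a pair of functions on the
two parts that agree at the glued points. -/
theorem numOrbits_glue_eq_one_iff {D₁ D₂ D : Type} [Finite D] (G : D₁ ⊕ D₂ ≃ D)
    {e₁ t₁ : Perm D₁} {e₂ t₂ : Perm D₂} {e t : Perm D} {o₁ : ZMod 4 → D₁} {o₂ : ZMod 4 → D₂}
    (he₁ : ∀ d, e (G (.inl d)) = G (.inl (e₁ d))) (he₂ : ∀ d, e (G (.inr d)) = G (.inr (e₂ d)))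
    (ht₁ : ∀ d, d ∉ Set.range o₁ → t (G (.inl d)) = G (.inl (t₁ d)))
    (ht₂ : ∀ d, d ∉ Set.range o₂ → t (G (.inr d)) = G (.inr (t₂ d)))
    (ho₁ : ∀ i, t (G (.inl (o₁ i))) = G (.inr (o₂ i)))
    (ho₂ : ∀ i, t (G (.inr (o₂ i))) = G (.inl (o₁ i))) :
    numOrbits {e, t} = 1 ↔
      ∀ f₁ f₂, IsLoose e₁ t₁ o₁ f₁ → IsLoose e₂ t₂ o₂ f₂ → (∀ i, f₁ (o₁ i) = f₂ (o₂ i)) →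
        (∀ d, f₁ d = f₁ (o₁ 0)) ∧ ∀ d, f₂ d = f₁ (o₁ 0) := by
  have : Nonempty D := ⟨G (.inl (o₁ 0))⟩
  refine (numOrbits_pair_eq_one_iff _ _).trans ⟨fun h f₁ f₂ h₁ h₂ h₁₂ => ?_, fun h f he hj => ?_⟩
  · have hc := h (fun d => Sum.elim f₁ f₂ (G.symm d)) (fun d => ?_) fun d => ?_
    · have hd := fun d => hc (G d) (G (.inl (o₁ 0)))
      simp only [Equiv.symm_apply_apply] at hd
      exact ⟨fun d => hd (.inl d), fun d => hd (.inr d)⟩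
    · obtain ⟨d | d, rfl⟩ := G.surjective d
      · simp only [he₁, Equiv.symm_apply_apply, Sum.elim_inl, h₁.edge]
      · simp only [he₂, Equiv.symm_apply_apply, Sum.elim_inr, h₂.edge]
    · obtain ⟨d | d, rfl⟩ := G.surjective d
      · by_cases hd : d ∈ Set.range o₁
        · obtain ⟨i, rfl⟩ := hd
          simp only [ho₁, Equiv.symm_apply_apply, Sum.elim_inl, Sum.elim_inr, h₁₂]
        · simp only [ht₁ d hd, Equiv.symm_apply_apply, Sum.elim_inl, h₁.join d hd]
      · by_cases hd : d ∈ Set.range o₂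
        · obtain ⟨i, rfl⟩ := hd
          simp only [ho₂, Equiv.symm_apply_apply, Sum.elim_inl, Sum.elim_inr, h₁₂]
        · simp only [ht₂ d hd, Equiv.symm_apply_apply, Sum.elim_inr, h₂.join d hd]
  · obtain ⟨c1, c2⟩ := h (fun d => f (G (.inl d))) (fun d => f (G (.inr d)))
      ⟨fun d => by rw [← he₁, he], fun d hd => by rw [← ht₁ d hd, hj]⟩
      ⟨fun d => by rw [← he₂, he], fun d hd => by rw [← ht₂ d hd, hj]⟩
      fun i => by rw [← ho₂, hj]
    have hc : ∀ d, f d = f (G (.inl (o₁ 0))) := fun d => by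
      obtain ⟨d | d, rfl⟩ := G.surjective d
      exacts [c1 d, c2 d]
    intro x y
    rw [hc x, hc y]

/-! ### Circles in the resolutions of a spherical tangle diagram -/

theorem Dart.join_join {X P : Type} (s : X → Bool) (k j : Fin 2) (d : Dart X P) :
    Dart.join s k j (Dart.join s k j d) = d :=
  Function.Involutive.toPerm_involutive _ d

theorem Dart.join_crossing {X P : Type} (s : X → Bool) (k j : Fin 2) (x : X) (i : ZMod 4) :
    Dart.join s k j (.crossing x i : Dart X P) = .crossing x (if s x then 3 - i else 1 - i) :=
  rfl

theorem alternating_sub {u : ZMod 4 → ZMod 2} (h : ∀ i, u (i + 1) = u i + 1) :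
    ∀ i, u (3 - i) = u i + 1 ∧ u (1 - i) = u i + 1 := by
  decide +revert

namespace SphericalTangle

/-- The checkerboard colouring of the regions of a diagram, as a colouring of the darts. -/
theorem exists_colouring (S : SphericalTangle) : ∃ g : Dart S.X S.P → ZMod 2,
    (∀ d, g (S.edge d) = g d + 1) ∧ ∀ (s : S.X → Bool) (k j : Fin 2) (d : Dart S.X S.P),
      g (Dart.join s k j d) = g d + 1 := by
  classical
  have := Fintype.ofFinite (Dart S.X S.P)
  obtain ⟨g, h1, h2⟩ := (isPlanarMap_iff _ _ S.edge_edge S.edge_ne).1 S.planar (fun _ => 1)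
    (fun _ => rfl) fun p hp => by
      -- Every vertex has even degree, so the set of all edges is a cycle: a function on vertices
      -- takes equal values on opposite darts, and its sum cancels. By planarity this cycle bounds a
      -- set of faces, which is the checkerboard colouring.
      let opp : Dart S.X S.P → Dart S.X S.P
        | .crossing x i => .crossing x (i + 2)
        | .bead p b => .bead p !b
        | .outer i => .outer (i + 2)
        | .hole i => .hole (i + 2)
      have add22 : ∀ i : ZMod 4, i + 2 + 2 = i := by decide
      have add11 : ∀ i : ZMod 4, i + 1 + 1 = i + 2 := by decide
      have sub11 : ∀ i : ZMod 4, i - 1 - 1 = i + 2 := by decide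
      have ne_add : ∀ i : ZMod 4, i + 2 ≠ i := by decide
      have two : ∀ a : ZMod 2, a + a = 0 := by decide
      have hopp : ∀ d, p (opp d) = p d := by
        rintro (⟨x, i⟩ | ⟨q, b⟩ | i | i)
        · have a := hp (.crossing x i)
          have b := hp (.crossing x (i + 1))
          simp only [Dart.rot, Equiv.coe_fn_mk, add11] at a b
          exact b.trans a
        · exact hp (.bead q b)
        · have a := hp (.outer i)
          have b := hp (.outer (i - 1))
          simp only [Dart.rot, Equiv.coe_fn_mk, sub11] at a b
          exact b.trans a
        · have a := hp (.hole i)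
          have b := hp (.hole (i + 1))
          simp only [Dart.rot, Equiv.coe_fn_mk, add11] at a b
          exact b.trans a
      refine Finset.sum_involution (fun d _ => opp d) (fun d _ => ?_) (fun d _ _ => ?_)
        (fun _ _ => Finset.mem_univ _) fun d _ => ?_
      · rw [hopp, two]
      · cases d <;> simp [opp, ne_add]
      · cases d <;> simp [opp, add22]
  have solve : ∀ a b : ZMod 2, 1 = a + b → b = a + 1 := by decide
  have he : ∀ d, g (S.edge d) = g d + 1 := fun d => solve _ _ (h2 d)
  have hr : ∀ d, g (Dart.rot S.X S.P d) = g d + 1 := fun d => by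
    have := h1 (Dart.rot S.X S.P d)
    rw [Perm.inv_def, Equiv.symm_apply_apply, he] at this
    rw [this, add_one_add_one_zmod_two]
  refine ⟨g, he, fun s k j d => ?_⟩
  rcases d with ⟨x, i⟩ | ⟨q, b⟩ | i | i
  · have := alternating_sub (u := fun i => g (.crossing x i)) (fun i => hr (.crossing x i)) i
    change g (.crossing x (if s x then 3 - i else 1 - i)) = _
    split_ifs
    exacts [this.1, this.2]
  · exact hr (.bead q b)
  · have := alternating_sub (u := fun i => g (.outer i)) (fun i => by
      have := hr (.outer (i + 1))
      simp only [Dart.rot, Equiv.coe_fn_mk, add_sub_cancel_right] at this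
      rw [this, add_one_add_one_zmod_two]) i
    change g (.outer (if k = 0 then 3 - i else 1 - i)) = _
    split_ifs
    exacts [this.1, this.2]
  · have := alternating_sub (u := fun i => g (.hole i)) (fun i => hr (.hole i)) i
    change g (.hole (if j = 0 then 1 - i else 3 - i)) = _
    split_ifs
    exacts [this.2, this.1]

variable (S : SphericalTangle)

/-! ### Parity of the number of circles -/

theorem odd_circles_add_circles (k j k' j' : Fin 2) (s s' : S.X → Bool)
    (o : ZMod 4 → Dart S.X S.P) (ho : Function.Injective o)
    (h : ∀ i, Dart.join s k j (o i) = o (3 - i)) (h' : ∀ i, Dart.join s' k' j' (o i) = o (1 - i))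
    (hoff : ∀ d, d ∉ Set.range o → Dart.join s' k' j' d = Dart.join s k j d) :
    Odd (S.circles k j s + S.circles k' j' s') := by
  obtain ⟨g, he, hj⟩ := S.exists_colouring
  exact odd_numOrbits_add_numOrbits g _ _ _ he (hj s k j) (hj s' k' j') S.edge_edge
    (Dart.join_join s k j) (Dart.join_join s' k' j') o ho h h' hoff

theorem odd_circles_update (k j : Fin 2) (s : S.X → Bool) (x : S.X) (hx : s x = true) :
    Odd (S.circles k j s + S.circles k j (Function.update s x false)) := by
  refine S.odd_circles_add_circles k j k j s _ (fun i => .crossing x i)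
    (fun _ _ h => (Dart.crossing.inj h).2) (fun i => ?_) (fun i => ?_) fun d hd => ?_
  · simp [Dart.join_crossing, hx]
  · simp [Dart.join_crossing]
  · rcases d with ⟨y, i⟩ | _ | _ | _
    · have : y ≠ x := by
        rintro rfl
        exact hd ⟨i, rfl⟩
      simp [Dart.join_crossing, this]
    all_goals rfl

theorem odd_circles_outer (j : Fin 2) (s : S.X → Bool) :
    Odd (S.circles 0 j s + S.circles 1 j s) := by
  refine S.odd_circles_add_circles 0 j 1 j s _ .outer
    (fun _ _ h => Dart.outer.inj h) (fun i => rfl) (fun i => rfl) fun d hd => ?_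
  rcases d with _ | _ | i | _
  on_goal 3 => exact absurd ⟨i, rfl⟩ hd
  all_goals rfl

theorem odd_circles_hole (k : Fin 2) (s : S.X → Bool) :
    Odd (S.circles k 1 s + S.circles k 0 s) := by
  refine S.odd_circles_add_circles k 1 k 0 s _ .hole
    (fun _ _ h => Dart.hole.inj h) (fun i => rfl) (fun i => rfl) fun d hd => ?_
  rcases d with _ | _ | _ | i
  on_goal 4 => exact absurd ⟨i, rfl⟩ hd
  all_goals rfl

/-- The number of `B`-type splittings of a state. -/
def numB (s : S.X → Bool) : ℕ := (Finset.univ.filter fun x => s x = false).card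

theorem cast_zmod_two_of_odd_add {a b : ℕ} (h : Odd (a + b)) : (b : ZMod 2) = a + 1 := by
  have h1 := (ZMod.natCast_eq_one_iff_odd).2 h
  have : ∀ a b : ZMod 2, a + b = 1 → b = a + 1 := by decide
  exact this _ _ (by exact_mod_cast h1)

/-- Every state and closure is reached from the all-`A` state with `k = j = 0` by single changes,
each of which flips the parity. -/
theorem circles_parity : ∃ c : ℕ, ∀ (k j : Fin 2) (s : S.X → Bool),
    (S.circles k j s : ZMod 2) = ((c + k + j + S.numB s : ℕ) : ZMod 2) := by
  have hs : ∀ (B : Finset S.X) (k j : Fin 2), (S.circles k j (fun x => decide (x ∉ B)) : ZMod 2) =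
      S.circles k j (fun _ => true) + B.card := by
    intro B k j
    induction B using Finset.induction_on with
    | empty => simp
    | insert x B hx ih =>
      have h := cast_zmod_two_of_odd_add (S.odd_circles_update k j (fun x => decide (x ∉ B)) x (by simpa using hx))
      have hu : Function.update (fun x => decide (x ∉ B)) x false =
          fun y => decide (y ∉ insert x B) := by
        ext y
        by_cases hy : y = x <;> simp [hy]
      rw [hu, ih] at h
      rw [h, Finset.card_insert_of_notMem hx]
      push_cast
      ring
  refine ⟨S.circles 0 0 fun _ => true, fun k j s => ?_⟩
  have hsB : s = fun x => decide (x ∉ Finset.univ.filter fun x => s x = false) := by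
    ext x
    simp
  rw [hsB, hs, ← hsB, numB]
  have ho := fun j => cast_zmod_two_of_odd_add (S.odd_circles_outer j fun _ => true)
  have hh := fun k => cast_zmod_two_of_odd_add
    (add_comm _ (S.circles k 0 _) ▸ S.odd_circles_hole k fun _ => true)
  push_cast
  congr 1
  fin_cases k <;> fin_cases j
  · simp
  · simpa using hh 0
  · simpa using ho 0
  · simpa [ho 0] using hh 1

theorem circles_ne_zero (k j : Fin 2) (s : S.X → Bool) : S.circles k j s ≠ 0 := by
  have : Nonempty (MulAction.orbitRel.Quotient
      (Subgroup.closure {S.edge, Dart.join s k j}) (Dart S.X S.P)) := ⟨Quotient.mk _ (.outer 0)⟩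
  exact Nat.card_ne_zero.2 ⟨this, Quotient.finite _⟩

/-! ### Gluing -/

theorem exists_outer_pairing (j : Fin 2) (s : S.X → Bool) :
    ∃ a, (∀ f, IsLoose S.edge (Dart.join s 0 j) .outer f →
        ∀ i, f (.outer (sidePairing a i)) = f (.outer i)) ∧
      (∃ h, IsLoose S.edge (Dart.join s 0 j) .outer h ∧ ∀ i, h (.outer i) = sideIndicator a i) ∧
      ∀ l, S.circles l j s = 1 ↔
        (∀ f, IsLoose S.edge (Dart.join s 0 j) .outer f → (∀ i, f (.outer i) = 0) →
          ∀ d, f d = 0) ∧ l ≠ a := by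
  obtain ⟨g, he, hj⟩ := S.exists_colouring
  refine exists_sidePairing g S.edge (fun l => Dart.join s l j) he (fun l => hj s l j) S.edge_edge
    (fun l => Dart.join_join s l j) .outer (fun _ _ h => Dart.outer.inj h) (fun l i => rfl)
    fun l d hd => ?_
  rcases d with _ | _ | i | _
  on_goal 3 => exact absurd ⟨i, rfl⟩ hd
  all_goals rfl

/-- The fillings are numbered oppositely to `sidePairing`, so `exists_sidePairing` is applied to the
filling `1 - l`. This turns its condition `l ≠ a` into `l = a`, which is what makes the inner index
match under composition. -/
theorem exists_hole_pairing (k : Fin 2) (s : S.X → Bool) :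
    ∃ a, (∀ f, IsLoose S.edge (Dart.join s k 1) .hole f →
        ∀ i, f (.hole (sidePairing a i)) = f (.hole i)) ∧
      (∃ h, IsLoose S.edge (Dart.join s k 1) .hole h ∧ ∀ i, h (.hole i) = sideIndicator a i) ∧
      ∀ l, S.circles k l s = 1 ↔
        (∀ f, IsLoose S.edge (Dart.join s k 1) .hole f → (∀ i, f (.hole i) = 0) →
          ∀ d, f d = 0) ∧ l = a := by
  obtain ⟨g, he, hj⟩ := S.exists_colouring
  obtain ⟨a, h1, h2, h3⟩ := exists_sidePairing g S.edge (fun l => Dart.join s k (1 - l)) he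
    (fun l => hj s k (1 - l)) S.edge_edge (fun l => Dart.join_join s k (1 - l)) .hole
    (fun _ _ h => Dart.hole.inj h) (fun l i => by fin_cases l <;> rfl) fun l d hd => by
      rcases d with _ | _ | _ | i
      on_goal 4 => exact absurd ⟨i, rfl⟩ hd
      all_goals rfl
  refine ⟨a, h1, h2, fun l => ?_⟩
  have h := h3 (1 - l)
  simp only [sub_sub_cancel] at h
  have hl : 1 - l ≠ a ↔ l = a := by clear * -; decide +revert
  rw [hl] at h
  exact h

variable (S₁ S₂ : SphericalTangle)

theorem comp_circles_eq_one_iff (k j : Fin 2) (s₁ : S₁.X → Bool) (s₂ : S₂.X → Bool) :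
    (S₂.comp S₁).circles k j (Sum.elim s₁ s₂) = 1 ↔
      ∀ f₁ f₂, IsLoose S₁.edge (Dart.join s₁ 0 j) .outer f₁ →
        IsLoose S₂.edge (Dart.join s₂ k 1) .hole f₂ → (∀ i, f₁ (.outer i) = f₂ (.hole i)) →
        (∀ d, f₁ d = f₁ (.outer 0)) ∧ ∀ d, f₂ d = f₁ (.outer 0) := by
  refine numOrbits_glue_eq_one_iff (Dart.glue S₁.X S₁.P S₂.X S₂.P)
    (e := (Dart.glue S₁.X S₁.P S₂.X S₂.P).permCongr (Equiv.sumCongr S₁.edge S₂.edge))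
    (t := Dart.join (Sum.elim s₁ s₂) k j) (fun d => by simp [Equiv.permCongr_apply])
    (fun d => by simp [Equiv.permCongr_apply]) ?_ ?_ (fun _ => rfl) (fun _ => rfl)
  · rintro (_ | _ | i | _) hd
    on_goal 3 => exact absurd ⟨i, rfl⟩ hd
    all_goals rfl
  · rintro (_ | _ | _ | i) hd
    on_goal 4 => exact absurd ⟨i, rfl⟩ hd
    all_goals rfl

/-- Let `a` be the pairing of the outer ends of the first part and `b` that of the hole ends of the
second. Only the term `l = b` of the sum can survive, and it does exactly when `b ≠ a` and no part
has a circle away from the glued points. -/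
theorem comp_circles_indicator (k j : Fin 2) (s₁ : S₁.X → Bool) (s₂ : S₂.X → Bool) :
    (if (S₂.comp S₁).circles k j (Sum.elim s₁ s₂) = 1 then (1 : ℂ) else 0) =
      ∑ l, (if S₂.circles k l s₂ = 1 then 1 else 0) * (if S₁.circles l j s₁ = 1 then 1 else 0) := by
  classical
  obtain ⟨a, pa, ⟨ha, hla, hia⟩, ca⟩ := S₁.exists_outer_pairing j s₁
  obtain ⟨b, pb, ⟨hb, hlb, hib⟩, cb⟩ := S₂.exists_hole_pairing k s₂
  have add_eq : ∀ x y : ZMod 2, x + y = 0 → x = y := by decide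
  have key : (S₂.comp S₁).circles k j (Sum.elim s₁ s₂) = 1 ↔
      ((∀ f, IsLoose S₂.edge (Dart.join s₂ k 1) .hole f → (∀ i, f (.hole i) = 0) →
          ∀ d, f d = 0) ∧
        (∀ f, IsLoose S₁.edge (Dart.join s₁ 0 j) .outer f → (∀ i, f (.outer i) = 0) →
          ∀ d, f d = 0)) ∧ b ≠ a := by
    rw [comp_circles_eq_one_iff]
    constructor
    · refine fun h => ⟨⟨fun f hf h0 d => ?_, fun f hf h0 d => ?_⟩, ?_⟩
      · exact (h (fun _ => 0) f (.const 0) hf fun i => (h0 i).symm).2 d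
      · rw [(h f (fun _ => 0) hf (.const 0) h0).1 d, h0]
      · rintro rfl
        -- If the pairings agree, the two indicator functions glue to an invariant function that is
        -- not constant.
        have := (h ha hb hla hlb fun i => by rw [hia, hib]).1 (.outer 2)
        rw [hia, hia] at this
        exact sideIndicator_two_ne_zero _ this
    · rintro ⟨⟨z2, z1⟩, hne⟩ f₁ f₂ h₁ h₂ h₁₂
      have h0 := add_eq_zero_of_sidePairing a b hne (fun i => f₁ (.outer i)) (pa f₁ h₁) fun i => by
        rw [h₁₂, h₁₂, pb f₂ h₂]
      exact ⟨fun d => add_eq _ _ (z1 _ (h₁.add (.const (f₁ (.outer 0)))) h0 d),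
        fun d => add_eq _ _ (z2 _ (h₂.add (.const (f₁ (.outer 0))))
          (fun i => by rw [← h₁₂]; exact h0 i) d)⟩
  simp only [key, ca, cb]
  rw [Finset.sum_eq_single b (fun l _ hl => by rw [if_neg fun h => hl h.2, zero_mul])
    fun h => absurd (Finset.mem_univ _) h, ite_zero_mul_ite_zero, mul_one]
  refine if_congr ?_ rfl rfl
  tauto

end SphericalTangle

/-! ### The bracket at a primitive eighth root of unity -/

theorem exp_pi_div_four_sq : Complex.exp (Complex.I * Real.pi / 4) ^ 2 = Complex.I := by
  rw [← Complex.exp_nat_mul]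
  refine Eq.trans (congrArg Complex.exp ?_) Complex.exp_pi_div_two_mul_I
  push_cast
  ring

theorem eq_one_or_neg_one_of_pow_eight {x : ℝ} (h : (x : ℂ) ^ 8 = 1) : x = 1 ∨ x = -1 := by
  have h' : x ^ 8 = 1 := by exact_mod_cast h
  have := (pow_eq_one_iff_of_ne_zero (n := 8) (by norm_num)).1 h'
  tauto

/-- Powers of `-i` whose exponents have the same parity differ by a sign. -/
theorem exists_neg_I_pow_eq {a b : ℕ} (h : (a : ZMod 2) = b) :
    ∃ m : ℤ, (-Complex.I) ^ a = (-Complex.I) ^ b * m := by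
  have hab : Even (b + a) := by
    rw [← ZMod.natCast_eq_zero_iff_even]
    push_cast
    rw [h]
    generalize (b : ZMod 2) = c
    revert c
    decide
  obtain ⟨q, hq⟩ := hab
  refine ⟨(-1) ^ a * (-1) ^ q, ?_⟩
  have h1 : (-Complex.I) ^ b * Complex.I ^ b = 1 := by
    rw [← mul_pow]
    simp
  calc (-Complex.I) ^ a = (-1) ^ a * (((-Complex.I) ^ b * Complex.I ^ b) * Complex.I ^ a) := by
        rw [h1, one_mul, ← mul_pow, neg_one_mul]
    _ = (-1) ^ a * ((-Complex.I) ^ b * (Complex.I ^ 2) ^ q) := by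
        rw [mul_assoc ((-Complex.I) ^ b), ← pow_add, hq, ← two_mul, pow_mul]
    _ = _ := by
        rw [Complex.I_sq]
        push_cast
        ring

namespace SphericalTangle

variable (S : SphericalTangle)

/-- The weight of a state in the bracket. -/
noncomputable def weight (A : ℂ) (s : S.X → Bool) : ℂ :=
  A ^ (Finset.univ.filter fun x => s x = true).card * A⁻¹ ^ (S.numB s)

theorem bracket_eq {A : ℂ} (hA : A ^ 2 = Complex.I) (k j : Fin 2) :
    S.bracket A k j = ∑ s, S.weight A s * if S.circles k j s = 1 then 1 else 0 := by
  have h0 : -A ^ 2 - A⁻¹ ^ 2 = 0 := by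
    rw [inv_pow, hA, Complex.inv_I]
    ring
  refine Finset.sum_congr rfl fun s _ => ?_
  rw [h0, zero_pow_eq]
  -- The truncated exponent `d - 1` would also vanish for `d = 0`, so it matters that there is at
  -- least one circle.
  have := S.circles_ne_zero k j s
  exact congrArg _ (if_congr (by omega) rfl rfl)

/-- Turning a splitting of type `A` into one of type `B` multiplies the weight by `A⁻² = -i`. -/
theorem weight_eq {A : ℂ} (hA : A ^ 2 = Complex.I) (s : S.X → Bool) :
    S.weight A s = A ^ Fintype.card S.X * (-Complex.I) ^ S.numB s := by
  have hA0 : A ≠ 0 := by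
    rintro rfl
    exact Complex.I_ne_zero (by simpa using hA.symm)
  have hcard : (Finset.univ.filter fun x => s x = true).card + S.numB s = Fintype.card S.X := by
    rw [numB, ← Finset.card_univ,
      ← Finset.card_filter_add_card_filter_not (s := Finset.univ) fun x => s x = true]
    simp
  rw [weight, ← hcard, pow_add, mul_assoc, ← mul_pow, ← Complex.inv_I, ← hA]
  congr 2
  field_simp

theorem exists_bracket_eq {A : ℂ} (hA : A ^ 2 = Complex.I) : ∃ c : ℕ, ∀ k j : Fin 2, ∃ m : ℤ,
    S.bracket A k j = A ^ Fintype.card S.X * (-Complex.I) ^ (c + k + j : ℕ) * m := by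
  obtain ⟨c, hc⟩ := S.circles_parity
  -- The shift by one comes from solving `1 = c + k + j + β` for `β` modulo 2.
  refine ⟨c + 1, fun k j => ?_⟩
  have hs : ∀ s, ∃ m : ℤ, (S.weight A s * if S.circles k j s = 1 then 1 else 0) =
      A ^ Fintype.card S.X * (-Complex.I) ^ (c + 1 + k + j : ℕ) * m := by
    intro s
    split_ifs with h
    · have hp := hc k j s
      rw [h] at hp
      have hB : (S.numB s : ZMod 2) = ((c + 1 + k + j : ℕ) : ZMod 2) := by
        push_cast at hp ⊢
        generalize (S.numB s : ZMod 2) = x at *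
        have : ∀ x y : ZMod 2, 1 = y + x → x = y + 1 := by decide
        rw [this _ _ hp]
        ring
      obtain ⟨m, hm⟩ := exists_neg_I_pow_eq hB
      exact ⟨m, by rw [weight_eq S hA, mul_one, hm, mul_assoc]⟩
    · exact ⟨0, by simp⟩
  choose m hm using hs
  refine ⟨∑ s, m s, ?_⟩
  rw [bracket_eq S hA, Finset.sum_congr rfl fun s _ => hm s, ← Finset.mul_sum, Int.cast_sum]

/-! ### Integrality, and uniqueness up to sign -/

theorem exists_mem_F : ∃ M, M ∈ S.F := by
  set A := Complex.exp (Complex.I * Real.pi / 4) with hAdef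
  have hA : A ^ 2 = Complex.I := exp_pi_div_four_sq
  have hA0 : A ≠ 0 := Complex.exp_ne_zero _
  obtain ⟨c, hc⟩ := S.exists_bracket_eq hA
  choose m hm using hc
  have hI8 : Complex.I ^ 8 = 1 := by
    rw [show 8 = 4 * 2 by norm_num, pow_mul, Complex.I_pow_four, one_pow]
  have hA8 : A ^ 8 = 1 := by
    rw [show 8 = 2 * 4 by norm_num, pow_mul, hA, Complex.I_pow_four]
  have hI : ∀ n : ℕ, (-Complex.I) ^ n * Complex.I ^ n = 1 := fun n => by
    rw [← mul_pow]
    simp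
  -- This root of unity cancels `Aⁿ(-i)^c`. The factor `i^k` cancels `(-i)^k`, while the two factors
  -- `(-i)^j` combine to the sign `(-1)^j`.
  refine ⟨Matrix.of fun k j => (-1) ^ j.val * m k j,
    (A ^ Fintype.card S.X)⁻¹ * Complex.I ^ c, ?_, fun k j => ?_⟩
  · rw [mul_pow, inv_pow, ← pow_mul, mul_comm _ 8, pow_mul, hA8, one_pow, ← pow_mul,
      mul_comm c 8, pow_mul, hI8, one_pow, inv_one, one_mul]
  · rw [← hAdef, hm]
    have hj : (-Complex.I) ^ (j : ℕ) * (-Complex.I) ^ (j : ℕ) = (-1) ^ (j : ℕ) := by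
      rw [← mul_pow]
      simp
    have hAn : (A ^ Fintype.card S.X)⁻¹ * A ^ Fintype.card S.X = 1 :=
      inv_mul_cancel₀ (pow_ne_zero _ hA0)
    rw [pow_add, pow_add]
    calc ((Matrix.of (fun k j => (-1) ^ j.val * m k j) k j : ℤ) : ℂ)
        = ((-Complex.I) ^ (j : ℕ) * (-Complex.I) ^ (j : ℕ)) * m k j *
          ((-Complex.I) ^ c * Complex.I ^ c) * ((-Complex.I) ^ (k : ℕ) * Complex.I ^ (k : ℕ)) *
          ((A ^ Fintype.card S.X)⁻¹ * A ^ Fintype.card S.X) := by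
          rw [hj, hI, hI, hAn]
          simp
      _ = _ := by ring

/-- A matrix in `F` is unique up to sign. -/
theorem F_eq_carrier {M : Matrix (Fin 2) (Fin 2) ℤ} (hM : M ∈ S.F) : S.F = (PM.mk M).carrier := by
  obtain ⟨z, hz, h⟩ := hM
  have hz0 : z ≠ 0 := by
    rintro rfl
    simp at hz
  ext N
  have hcar : N ∈ (PM.mk M).carrier ↔ N = M ∨ N = -M := Quotient.eq
  rw [hcar]
  constructor
  · rintro ⟨w, hw, h'⟩
    have hNM : ∀ k j, (N k j : ℂ) = w / z * M k j := fun k j => by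
      rw [h, h']
      field_simp
    by_cases hM0 : M = 0
    · left
      ext k j
      have := hNM k j
      rw [hM0] at this ⊢
      simpa using this
    · obtain ⟨k, j, hkj⟩ : ∃ k j, M k j ≠ 0 := by
        by_contra! hc
        exact hM0 (Matrix.ext hc)
      have hc : (M k j : ℂ) ≠ 0 := by exact_mod_cast hkj
      -- A nonzero entry shows that the ratio of the two roots of unity is real.
      have hq : w / z = (((N k j : ℝ) / (M k j : ℝ) : ℝ) : ℂ) := by
        push_cast
        rw [hNM k j]
        field_simp
      have hq8 : (w / z) ^ 8 = 1 := by rw [div_pow, hw, hz, div_one]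
      rw [hq] at hq8
      rcases eq_one_or_neg_one_of_pow_eight hq8 with h1 | h1
      · left
        ext k' j'
        have := hNM k' j'
        rw [hq, h1] at this
        simpa using this
      · right
        ext k' j'
        have := hNM k' j'
        rw [hq, h1] at this
        rw [Matrix.neg_apply]
        exact_mod_cast (by simpa using this : (N k' j' : ℂ) = -M k' j')
  · rintro (rfl | rfl)
    · exact ⟨z, hz, h⟩
    · refine ⟨-z, by rw [← hz]; ring, fun k j => ?_⟩
      rw [Matrix.neg_apply, Int.cast_neg, h]
      ring

/-! ### Multiplicativity -/

variable (S₁ S₂ : SphericalTangle)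

theorem comp_weight (A : ℂ) (s₁ : S₁.X → Bool) (s₂ : S₂.X → Bool) :
    (S₂.comp S₁).weight A (Sum.elim s₁ s₂) = S₂.weight A s₂ * S₁.weight A s₁ := by
  have hcard : ∀ b : Bool,
      (Finset.univ.filter fun x : S₁.X ⊕ S₂.X => Sum.elim s₁ s₂ x = b).card =
        (Finset.univ.filter fun x => s₁ x = b).card +
        (Finset.univ.filter fun x => s₂ x = b).card := fun b => by
    simp only [← Fintype.card_subtype]
    rw [← Fintype.card_sum]
    exact Fintype.card_congr subtypeSum
  have ht := hcard true
  have hf : (S₂.comp S₁).numB (Sum.elim s₁ s₂) = S₁.numB s₁ + S₂.numB s₂ := by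
    exact hcard false
  have hw : (S₂.comp S₁).weight A (Sum.elim s₁ s₂) =
      A ^ (Finset.univ.filter fun x : S₁.X ⊕ S₂.X => Sum.elim s₁ s₂ x = true).card *
        A⁻¹ ^ (S₂.comp S₁).numB (Sum.elim s₁ s₂) := rfl
  rw [hw, ht, hf, weight, weight, pow_add, pow_add]
  ring

/-- A state of the composite is a pair of states. Weights multiply, and the indicators of a single
circle multiply as matrices. -/
theorem comp_bracket {A : ℂ} (hA : A ^ 2 = Complex.I) (k j : Fin 2) :
    (S₂.comp S₁).bracket A k j = ∑ l, S₂.bracket A k l * S₁.bracket A l j := by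
  rw [bracket_eq _ hA]
  have hsum : ∀ f : ((S₂.comp S₁).X → Bool) → ℂ,
      ∑ s, f s = ∑ s₂ : S₂.X → Bool, ∑ s₁ : S₁.X → Bool, f (Sum.elim s₁ s₂) := fun f => by
    rw [Finset.sum_comm, ← Fintype.sum_prod_type']
    exact (Equiv.sum_comp (sumArrowEquivProdArrow S₁.X S₂.X Bool).symm f).symm
  rw [hsum]
  simp only [comp_weight, comp_circles_indicator, bracket_eq _ hA, Finset.sum_mul_sum]
  rw [Finset.sum_comm]
  simp only [Finset.mul_sum]
  rw [Finset.sum_comm]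
  rw [Finset.sum_comm (s := (Finset.univ : Finset (Fin 2)))]
  refine Finset.sum_congr rfl fun s₂ _ => ?_
  rw [Finset.sum_comm]
  refine Finset.sum_congr rfl fun l _ => Finset.sum_congr rfl fun s₁ _ => ?_
  ring

theorem mul_mem_F {M₁ M₂ : Matrix (Fin 2) (Fin 2) ℤ} (h₁ : M₁ ∈ S₁.F) (h₂ : M₂ ∈ S₂.F) :
    M₂ * M₁ ∈ (S₂.comp S₁).F := by
  obtain ⟨z₁, hz₁, h₁⟩ := h₁
  obtain ⟨z₂, hz₂, h₂⟩ := h₂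
  refine ⟨z₂ * z₁, by rw [mul_pow, hz₁, hz₂, one_mul], fun k j => ?_⟩
  rw [Matrix.mul_apply, comp_bracket _ _ exp_pi_div_four_sq, Finset.mul_sum, Int.cast_sum]
  refine Finset.sum_congr rfl fun l _ => ?_
  -- The column factor of the left matrix cancels the row factor of the right one at the inner
  -- index.
  have hl : (-Complex.I) ^ (l : ℕ) * Complex.I ^ (l : ℕ) = 1 := by
    rw [← mul_pow]
    simp
  rw [Int.cast_mul, h₂, h₁]
  linear_combination ((-Complex.I) ^ (j : ℕ) * Complex.I ^ (k : ℕ) * (z₂ * z₁) *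
    (S₂.bracket (Complex.exp (Complex.I * Real.pi / 4)) k l *
      S₁.bracket (Complex.exp (Complex.I * Real.pi / 4)) l j)) * hl

end SphericalTangle

theorem corollary3p6 (S₁ S₂ : SphericalTangle) :
    ∃ a₁ a₂ : PM 2 2, S₁.F = a₁.carrier ∧ S₂.F = a₂.carrier ∧
      (S₂.comp S₁).F = (a₂.mul a₁).carrier := by
  obtain ⟨M₁, h₁⟩ := S₁.exists_mem_F
  obtain ⟨M₂, h₂⟩ := S₂.exists_mem_F
  exact ⟨PM.mk M₁, PM.mk M₂, S₁.F_eq_carrier h₁, S₂.F_eq_carrier h₂,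
    (S₂.comp S₁).F_eq_carrier (S₁.mul_mem_F S₂ h₁ h₂)⟩
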